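/- Let $p\ge 1$ and let $\sigma:\mathbb{R}\to\mathbb{R}$ be $p$-homogeneous, i.e. $\sigma(\alpha t)=\alpha^p\sigma(t)$ for all $t\in\mathbb{R}$ and $\alpha\ge 0$, with $\sigma(0)=0$ and $|\sigma(t)|\le L_\sigma|t|^p$ for all $t\in\mathbb{R}$, for some constant $L_\sigma<\infty$. Let $\gamma\sim\mathcal N(0,1)$, put $m_1:=|\mathbb{E}[\sigma(\gamma)]|$ and $m_2:=\mathbb{E}[\sigma(\gamma)^2]$, and assume $m_1>0$. Then there exists a constant $c>0$, depending only on $p,\sigma(1),\sigma(-1),m_1$, such that the following holds for all $0<\varepsilon_1\le 1$ and $0<\varepsilon_2<1$, all depths $L$, all widths $d_0,\dots,d_L$, all $n$, and every fixed data matrix $X\in\mathbb{R}^{d_0\times n}$. Let $W_\ell\in\mathbb{R}^{d_\ell\times d_{\ell-1}}$, $\ell=1,\dots,L$, be independent random matrices, where $W_\ell$ has i.i.d. $\mathcal N(0,1/d_{\ell-1})$ entries, and define $A_0=X$ and $A_\ell=\sigma(W_\ell A_{\ell-1})$ for $\ell=1,\dots,L$, with $\sigma$ applied entrywise. Let $\mathrm{st}(A)=\|A\|_F^2/\|A\|_{\mathrm{op}}^2$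 denote the stable rank (with $\mathrm{st}(0):=0$). Then with probability at least \[ 1-\sum_{\ell=1}^L\Big(2\exp\big(-c\min\{d_\ell\varepsilon_2^2,\ d_\ell^{\min(1,2/p)}\varepsilon_2^{2/p}\}\big)+2\exp\big(-c\min\{d_\ell\varepsilon_1^2,\ d_\ell^{\min(1,1/p)}\varepsilon_1^{1/p}\}\big)\Big), \] simultaneously for every $\ell=1,\dots,L$, \[ \mathrm{st}(A_\ell)\le\frac{1+\varepsilon_1}{(1-\varepsilon_2)^2}\cdot\frac{m_2}{m_1^2}, \] and moreover $A_\ell\ne 0$ if $X\neq 0$ (so that $\mathrm{st}(A_\ell)$ is a genuine quotient). -/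

import Mathlib

open MeasureTheory ProbabilityTheory
open scoped NNReal

noncomputable section

/-- The Frobenius norm of a real matrix. -/
def frobNorm {m n : ℕ} (A : Matrix (Fin m) (Fin n) ℝ) : ℝ :=
  @norm _ Matrix.frobeniusNormedAddCommGroup.toNorm A

/-- The operator norm of a real matrix, as a map between Euclidean spaces. -/
def opNorm {m n : ℕ} (A : Matrix (Fin m) (Fin n) ℝ) : ℝ :=
  @norm _ Matrix.instL2OpNormedAddCommGroup.toNorm A

/-- The stable rank `‖A‖_F² / ‖A‖_op²` (with value `0` at the zero matrix). -/
def stableRank {m n : ℕ} (A : Matrix (Fin m) (Fin n) ℝ) : ℝ :=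
  frobNorm A ^ 2 / opNorm A ^ 2

/-- `σ(α t) = α ^ p σ(t)` for all real `t` and all `α ≥ 0`. -/
def IsPosHomogeneous (p : ℝ) (σ : ℝ → ℝ) : Prop :=
  ∀ α t : ℝ, 0 ≤ α → σ (α * t) = α ^ p * σ t

/-- Post-activation matrices of a bias-free MLP: `A_0 = X` and `A_{ℓ+1} = σ(W_{ℓ+1} A_ℓ)`,
with `σ` applied entrywise. The weight matrix `W_{ℓ+1}` has index `ℓ : Fin L`. -/
def postActivation {L : ℕ} {d : Fin (L + 1) → ℕ} {n : ℕ} (σ : ℝ → ℝ)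
    (W : (ℓ : Fin L) → Matrix (Fin (d ℓ.succ)) (Fin (d ℓ.castSucc)) ℝ)
    (X : Matrix (Fin (d 0)) (Fin n) ℝ) (ℓ : Fin (L + 1)) : Matrix (Fin (d ℓ)) (Fin n) ℝ :=
  Fin.induction (motive := fun k => Matrix (Fin (d k)) (Fin n) ℝ) X
    (fun k A => (W k * A).map σ) ℓ

/-- Gaussian initialization: all entries of all weight matrices are jointly independent, and the
entries of `W_{ℓ+1}`, a matrix of size `d_{ℓ+1} × d_ℓ`, have law `N(0, 1/d_ℓ)`. -/
structure IsGaussianInit {Ω : Type*} [MeasurableSpace Ω] (μ : Measure Ω) {L : ℕ}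
    {d : Fin (L + 1) → ℕ}
    (W : (ℓ : Fin L) → Ω → Matrix (Fin (d ℓ.succ)) (Fin (d ℓ.castSucc)) ℝ) : Prop where
  measurable : ∀ ℓ i j, Measurable fun ω => W ℓ ω i j
  law : ∀ ℓ i j, μ.map (fun ω => W ℓ ω i j) = gaussianReal 0 ((d ℓ.castSucc : ℝ≥0)⁻¹)
  indep : iIndepFun
    (fun (k : (ℓ : Fin L) × (Fin (d ℓ.succ) × Fin (d ℓ.castSucc))) (ω : Ω) =>
      W k.1 ω k.2.1 k.2.2) μ

end

/-!
Condition on the input `a` of a layer: the entries of `V a` in column `j` are `s_j` times a standard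
Gaussian, where `s_j` is the Euclidean norm of column `j` of `a` up to the normalization of the
weights, and different rows are independent. Put `u_j = s_j ^ p`. By homogeneity the output
`A = σ(V a)` satisfies `∑ i j, u_j A_ij = ∑ i j, u_j² σ(G_ij)` and
`‖A‖_F² = ∑ i j, u_j² σ(G_ij)²` with `G_ij` standard Gaussian, so both are sums over independent
rows of weighted averages of a fixed function of Gaussians, with the same weights `u_j²`. Testing
the operator norm of `A`, which has `N` rows, on the all-ones vector and on `u` gives
`st(A) ≤ ‖A‖_F² N ‖u‖² / (∑ i j, u_j A_ij)²`, where the unknown weights cancel.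

The summands only have stretched-exponential tails `exp (-κ x ^ α)` with `α ≤ 1`, so they are
truncated at the deviation level before applying Chernoff's bound. A weighted average over a row
inherits the exponential moment although `exp (κ x ^ α)` fails to be convex when `α < 1`. The
weights of a layer are independent of its input, and a union bound over the layers concludes.
-/

/-! ### Elementary inequalities -/

lemma exp_le_one_add_add_sq_mul_exp (x : ℝ) :
    Real.exp x ≤ 1 + x + x ^ 2 * Real.exp (max x 0) := by
  rcases le_total 0 x with hx | hx
  · have hexp_sub_one : Real.exp x - 1 ≤ x * Real.exp x := by
      have hneg := Real.add_one_le_exp (-x)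
      have hinv : Real.exp (-x) * Real.exp x = 1 := by rw [← Real.exp_add]; simp
      nlinarith [Real.exp_pos x]
    rw [max_eq_left hx]
    nlinarith [mul_le_mul_of_nonneg_left hexp_sub_one hx]
  · rw [max_eq_right hx, Real.exp_zero, mul_one]
    rcases le_total (-1) x with hx' | hx'
    · have := Real.abs_exp_sub_one_sub_id_le (x := x) (abs_le.2 ⟨hx', by linarith⟩)
      linarith [(abs_le.1 this).2]
    · nlinarith [Real.exp_le_one_iff.2 hx]

lemma rpow_le_mul_exp_rpow {α κ s u : ℝ} (hα : 0 < α) (hκ : 0 < κ) (hs : 0 < s) (hu : 0 ≤ u) :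
    u ^ s ≤ (s / (α * κ)) ^ (s / α) * Real.exp (κ * u ^ α) := by
  set v := α * κ * u ^ α / s with hv
  have hv0 : 0 ≤ v := by positivity
  have hle : v ^ (s / α) ≤ Real.exp (κ * u ^ α) := by
    calc v ^ (s / α) ≤ Real.exp v ^ (s / α) := by
          gcongr; linarith [Real.add_one_le_exp v]
      _ = Real.exp (κ * u ^ α) := by rw [← Real.exp_mul, hv]; congr 1; field_simp
  calc u ^ s = (s / (α * κ) * v) ^ (s / α) := by
        rw [show s / (α * κ) * v = u ^ α by rw [hv]; field_simp, ← Real.rpow_mul hu]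
        congr 1; field_simp
    _ = (s / (α * κ)) ^ (s / α) * v ^ (s / α) := Real.mul_rpow (by positivity) hv0
    _ ≤ _ := by gcongr

/-- The function `x ↦ exp (b x ^ α)` is not convex near `0`, but the tangent at `x = 1` still lies
below its graph as soon as `1 ≤ α b`. -/
lemma one_add_mul_sub_one_le_exp_rpow {α b x : ℝ} (hα : 0 < α) (hb : 1 ≤ α * b) (hx : 0 ≤ x) :
    1 + α * b * (x - 1) ≤ Real.exp (b * (x ^ α - 1)) := by
  have hx_le : x ≤ Real.exp ((x ^ α - 1) / α) := by
    calc x = (x ^ α) ^ α⁻¹ := (Real.rpow_rpow_inv hx hα.ne').symm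
      _ ≤ Real.exp (x ^ α - 1) ^ α⁻¹ := by
        gcongr; linarith [Real.add_one_le_exp (x ^ α - 1)]
      _ = _ := by rw [← Real.exp_mul, div_eq_mul_inv]
  calc 1 + α * b * (x - 1) ≤ (1 + (x - 1)) ^ (α * b) :=
        one_add_mul_self_le_rpow_one_add (by linarith) hb
    _ ≤ Real.exp ((x ^ α - 1) / α) ^ (α * b) := by
        rw [add_sub_cancel]; gcongr
    _ = _ := by rw [← Real.exp_mul]; congr 1; field_simp

lemma exp_mul_sum_rpow_le {ι : Type*} [Fintype ι] {α κ : ℝ} (hα : 0 < α)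
    {w z : ι → ℝ} (hw : ∀ j, 0 ≤ w j) (hw1 : ∑ j, w j = 1) (hz : ∀ j, 0 ≤ z j) :
    Real.exp (κ * (∑ j, w j * z j) ^ α) ≤
      Real.exp α⁻¹ + ∑ j, w j * Real.exp (κ * z j ^ α) := by
  set y := ∑ j, w j * z j with hy
  have hy0 : 0 ≤ y := Finset.sum_nonneg fun j _ => mul_nonneg (hw j) (hz j)
  rcases le_total (κ * y ^ α) α⁻¹ with hsmall | hlarge
  · have hsum : 0 ≤ ∑ j, w j * Real.exp (κ * z j ^ α) :=
      Finset.sum_nonneg fun j _ => mul_nonneg (hw j) (Real.exp_pos _).le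
    linarith [Real.exp_le_exp.2 hsmall]
  · have hypos : 0 < y := by
      refine hy0.lt_of_ne' fun h => ?_
      rw [h, Real.zero_rpow hα.ne', mul_zero] at hlarge
      exact absurd hlarge (not_le.2 (inv_pos.2 hα))
    set b := κ * y ^ α with hb
    have hαb : 1 ≤ α * b := by rwa [inv_le_iff_one_le_mul₀' hα] at hlarge
    have htangent (j : ι) :
        Real.exp b * (1 + α * b * (z j / y - 1)) ≤ Real.exp (κ * z j ^ α) := by
      calc _ ≤ Real.exp b * Real.exp (b * ((z j / y) ^ α - 1)) := by
            gcongr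
            exact one_add_mul_sub_one_le_exp_rpow hα hαb (div_nonneg (hz j) hy0)
        _ = Real.exp (κ * z j ^ α) := by
            rw [← Real.exp_add, Real.div_rpow (hz j) hy0, hb]
            congr 1
            field_simp
            ring
    have haverage : ∑ j, w j * (Real.exp b * (1 + α * b * (z j / y - 1))) = Real.exp b := by
      calc _ = Real.exp b * ((1 - α * b) * ∑ j, w j + α * b / y * y) := by
            rw [hy, Finset.mul_sum, Finset.mul_sum, ← Finset.sum_add_distrib, Finset.mul_sum]
            exact Finset.sum_congr rfl fun j _ => by ring
        _ = Real.exp b := by rw [hw1, div_mul_cancel₀ _ hypos.ne']; ring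
    calc Real.exp b ≤ ∑ j, w j * Real.exp (κ * z j ^ α) := by
          rw [← haverage]
          exact Finset.sum_le_sum fun j _ => mul_le_mul_of_nonneg_left (htangent j) (hw j)
      _ ≤ _ := le_add_of_nonneg_left (Real.exp_pos _).le

/-! ### Bernstein's inequality for stretched-exponential tails -/

/-- The stretched-exponential moment bound `𝔼 exp (κ |ξ| ^ α) ≤ K`. Integrability is part of the
definition because the integral of a non-integrable function is `0`. -/
structure HasExpMomentLE {Ω : Type*} [MeasurableSpace Ω] (ξ : Ω → ℝ) (α κ K : ℝ)
    (μ : Measure Ω) : Prop where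
  integrable_exp : Integrable (fun ω => Real.exp (κ * |ξ ω| ^ α)) μ
  integral_exp_le : ∫ ω, Real.exp (κ * |ξ ω| ^ α) ∂μ ≤ K

/-- The constant `C` for which `u ^ 2 ≤ C exp (κ / 2 * u ^ α)` for all `u ≥ 0`. -/
noncomputable def sqExpConst (α κ : ℝ) : ℝ := (4 / (α * κ)) ^ (2 / α)

/-- The rate in Bernstein's inequality for centred variables with `𝔼 exp (κ |ξ| ^ α) ≤ K`. -/
noncomputable def bernsteinRate (α κ K : ℝ) : ℝ := min (κ / 4) (1 / (4 * (sqExpConst α κ * K)))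

/-- The two-regime bound `2 exp (-c min {N ε², (N ε) ^ α})` for the probability that the sum of `N`
independent centred variables exceeds `N ε`. -/
noncomputable def bernsteinTail (c α N ε : ℝ) : ℝ :=
  2 * Real.exp (-c * min (N * ε ^ 2) ((N * ε) ^ α))

section BernsteinTail

variable {c c' α r N ε : ℝ}

lemma bernsteinTail_nonneg : 0 ≤ bernsteinTail c α N ε := by
  unfold bernsteinTail; positivity

lemma bernsteinTail_zero (hα : 0 < α) : bernsteinTail c α 0 ε = 2 := by
  simp [bernsteinTail, Real.zero_rpow hα.ne']

lemma bernsteinTail_anti (hN : 0 ≤ N) (hε : 0 ≤ ε) (h : c ≤ c') :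
    bernsteinTail c' α N ε ≤ bernsteinTail c α N ε := by
  unfold bernsteinTail
  have : 0 ≤ min (N * ε ^ 2) ((N * ε) ^ α) := by positivity
  gcongr

lemma bernsteinTail_min_one_le (hc : 0 ≤ c) (hN : 0 ≤ N) (hε : 0 < ε) (hε1 : ε ≤ 1) :
    bernsteinTail c (min 1 r) N ε ≤
      2 * Real.exp (-c * min (N * ε ^ 2) (N ^ min 1 r * ε ^ r)) := by
  have hε_rpow : ε ^ r ≤ ε ^ min 1 r :=
    Real.rpow_le_rpow_of_exponent_ge hε hε1 (min_le_right _ _)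
  rw [bernsteinTail, Real.mul_rpow hN hε.le, neg_mul, neg_mul]
  gcongr

end BernsteinTail

section SqExpConst

variable {α κ : ℝ}

lemma sqExpConst_pos (hα : 0 < α) (hκ : 0 < κ) : 0 < sqExpConst α κ := by
  unfold sqExpConst; positivity

lemma sq_le_sqExpConst_mul_exp (hα : 0 < α) (hκ : 0 < κ) (u : ℝ) :
    u ^ 2 ≤ sqExpConst α κ * Real.exp (κ / 2 * |u| ^ α) := by
  calc u ^ 2 = |u| ^ (2 : ℝ) := by rw [Real.rpow_two, sq_abs]
    _ ≤ (2 / (α * (κ / 2))) ^ (2 / α) * Real.exp (κ / 2 * |u| ^ α) :=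
        rpow_le_mul_exp_rpow hα (half_pos hκ) two_pos (abs_nonneg u)
    _ = _ := by rw [sqExpConst]; congr 2; field_simp; norm_num

lemma bernsteinRate_pos {K : ℝ} (hα : 0 < α) (hκ : 0 < κ) (hK : 0 < K) :
    0 < bernsteinRate α κ K := by
  have := sqExpConst_pos hα hκ
  unfold bernsteinRate; positivity

lemma bernsteinRate_mul_le {K : ℝ} (hα : 0 < α) (hκ : 0 < κ) (hK : 0 < K) :
    bernsteinRate α κ K * (sqExpConst α κ * K) ≤ 1 / 4 := by
  have := sqExpConst_pos hα hκ
  calc _ ≤ 1 / (4 * (sqExpConst α κ * K)) * (sqExpConst α κ * K) := by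
        gcongr; exact min_le_right _ _
    _ = 1 / 4 := by field_simp

lemma one_le_two_mul_exp_neg_bernsteinRate_mul {K N t : ℝ} (hα : 0 < α) (hκ : 0 < κ) (hK : 0 < K)
    (hN : 0 < N) (ht : 0 < t) (h : Real.exp (κ / 2 * t ^ α) ≤ N * K) :
    1 ≤ 2 * Real.exp (-bernsteinRate α κ K * min (t ^ 2 / N) (t ^ α)) := by
  have hC := sqExpConst_pos hα hκ
  have hmin : min (t ^ 2 / N) (t ^ α) ≤ sqExpConst α κ * K := by
    refine (min_le_left _ _).trans ((div_le_iff₀ hN).2 ?_)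
    calc t ^ 2 ≤ sqExpConst α κ * Real.exp (κ / 2 * t ^ α) := by
          simpa only [abs_of_pos ht] using sq_le_sqExpConst_mul_exp hα hκ t
      _ ≤ sqExpConst α κ * (N * K) := by gcongr
      _ = _ := by ring
  have hexponent : bernsteinRate α κ K * min (t ^ 2 / N) (t ^ α) ≤ 1 / 4 :=
    (mul_le_mul_of_nonneg_left hmin (bernsteinRate_pos hα hκ hK).le).trans
      (bernsteinRate_mul_le hα hκ hK)
  linarith [Real.add_one_le_exp (-bernsteinRate α κ K * min (t ^ 2 / N) (t ^ α))]

end SqExpConst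

namespace HasExpMomentLE

variable {Ω : Type*} [MeasurableSpace Ω] {μ : Measure Ω} {ξ : Ω → ℝ} {α κ K : ℝ}

lemma pos [NeZero μ] (h : HasExpMomentLE ξ α κ K μ) : 0 < K :=
  (integral_exp_pos h.integrable_exp).trans_le h.integral_exp_le

lemma integrable (h : HasExpMomentLE ξ α κ K μ) (hα : 0 < α) (hκ : 0 < κ)
    (hξ : AEStronglyMeasurable ξ μ) : Integrable ξ μ := by
  refine (h.integrable_exp.const_mul ((1 / (α * κ)) ^ (1 / α))).mono' hξ (ae_of_all _ fun ω => ?_)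
  simpa using rpow_le_mul_exp_rpow hα hκ one_pos (abs_nonneg (ξ ω))

lemma measureReal_ge_le (h : HasExpMomentLE ξ α κ K μ) [IsFiniteMeasure μ] (hα : 0 < α)
    (hκ : 0 < κ) {t : ℝ} (ht : 0 ≤ t) :
    μ.real {ω | t ≤ ξ ω} ≤ K * Real.exp (-(κ * t ^ α)) := by
  have hmarkov : Real.exp (κ * t ^ α) *
      μ.real {ω | Real.exp (κ * t ^ α) ≤ Real.exp (κ * |ξ ω| ^ α)} ≤ K :=
    (mul_meas_ge_le_integral_of_nonneg (ae_of_all _ fun ω => (Real.exp_pos _).le)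
      h.integrable_exp _).trans h.integral_exp_le
  have hsubset : {ω | t ≤ ξ ω} ⊆ {ω | Real.exp (κ * t ^ α) ≤ Real.exp (κ * |ξ ω| ^ α)} := by
    intro ω hω
    have : t ≤ |ξ ω| := le_trans hω (le_abs_self _)
    simp only [Set.mem_ofPred_eq]
    gcongr
  rw [Real.exp_neg, ← div_eq_mul_inv, le_div_iff₀' (Real.exp_pos _)]
  exact (mul_le_mul_of_nonneg_left (measureReal_mono hsubset) (Real.exp_pos _).le).trans hmarkov

end HasExpMomentLE

lemma exp_mul_min_le {α κ l t : ℝ} (hα : 0 < α) (hα1 : α ≤ 1) (hκ : 0 < κ) (ht : 0 < t)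
    (hl : 0 ≤ l) (hlt : l * t ^ (1 - α) ≤ κ / 2) (x : ℝ) :
    Real.exp (l * min x t) ≤
      1 + l * x + l ^ 2 * (sqExpConst α κ * Real.exp (κ * |x| ^ α)) := by
  set y := min x t
  have hyx : |y| ≤ |x| := by
    rcases le_total x t with h | h
    · rw [show y = x from min_eq_left h]
    · rw [show y = t from min_eq_right h, abs_of_pos ht, abs_of_pos (ht.trans_le h)]
      exact h
  have hmax : max (l * y) 0 ≤ κ / 2 * |x| ^ α := by
    refine max_le ?_ (by positivity)
    rcases le_or_gt y 0 with hy | hy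
    · exact (mul_nonpos_of_nonneg_of_nonpos hl hy).trans (by positivity)
    · calc l * y = l * y ^ (1 - α) * y ^ α := by
            rw [mul_assoc, ← Real.rpow_add hy, sub_add_cancel, Real.rpow_one]
        _ ≤ l * t ^ (1 - α) * |y| ^ α := by
            gcongr
            · exact min_le_right _ _
            · exact le_abs_self y
        _ ≤ κ / 2 * |x| ^ α := by gcongr
  have hremainder : (l * y) ^ 2 * Real.exp (max (l * y) 0) ≤
      l ^ 2 * (sqExpConst α κ * Real.exp (κ * |x| ^ α)) := by
    calc _ ≤ l ^ 2 * x ^ 2 * Real.exp (κ / 2 * |x| ^ α) := by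
          rw [mul_pow]
          gcongr ?_ * ?_ * ?_
          · exact sq_le_sq.2 hyx
          · exact Real.exp_le_exp.2 hmax
      _ ≤ l ^ 2 * (sqExpConst α κ * Real.exp (κ / 2 * |x| ^ α)) *
            Real.exp (κ / 2 * |x| ^ α) := by
          gcongr
          exact sq_le_sqExpConst_mul_exp hα hκ x
      _ = _ := by rw [mul_assoc, mul_assoc, ← Real.exp_add, ← add_mul, add_halves]
  have hlinear : l * y ≤ l * x := mul_le_mul_of_nonneg_left (min_le_left _ _) hl
  linarith [exp_le_one_add_add_sq_mul_exp (l * y)]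

lemma HasExpMomentLE.mgf_min_le {Ω : Type*} [MeasurableSpace Ω] {μ : Measure Ω}
    [IsProbabilityMeasure μ] {ξ : Ω → ℝ} {α κ K l t : ℝ} (h : HasExpMomentLE ξ α κ K μ)
    (hα : 0 < α) (hα1 : α ≤ 1) (hκ : 0 < κ) (hξ : Measurable ξ) (hmean : ∫ ω, ξ ω ∂μ = 0)
    (ht : 0 < t) (hl : 0 ≤ l) (hlt : l * t ^ (1 - α) ≤ κ / 2) :
    Integrable (fun ω => Real.exp (l * min (ξ ω) t)) μ ∧
      mgf (fun ω => min (ξ ω) t) μ l ≤ Real.exp (l ^ 2 * (sqExpConst α κ * K)) := by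
  have hC := sqExpConst_pos hα hκ
  have hle := fun ω => exp_mul_min_le hα hα1 hκ ht hl hlt (ξ ω)
  have hlin : Integrable (fun ω => 1 + l * ξ ω) μ :=
    (integrable_const 1).add ((h.integrable hα hκ hξ.aestronglyMeasurable).const_mul l)
  have hquad := (h.integrable_exp.const_mul (sqExpConst α κ)).const_mul (l ^ 2)
  have hintg : Integrable (fun ω => Real.exp (l * min (ξ ω) t)) μ := by
    refine (hlin.add hquad).mono' (by fun_prop) (ae_of_all _ fun ω => ?_)
    rw [Real.norm_of_nonneg (Real.exp_pos _).le]
    exact hle ω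
  refine ⟨hintg, ?_⟩
  calc mgf (fun ω => min (ξ ω) t) μ l
      ≤ ∫ ω, (1 + l * ξ ω + l ^ 2 * (sqExpConst α κ * Real.exp (κ * |ξ ω| ^ α))) ∂μ :=
        integral_mono hintg (hlin.add hquad) hle
    _ = 1 + l ^ 2 * (sqExpConst α κ * ∫ ω, Real.exp (κ * |ξ ω| ^ α) ∂μ) := by
        rw [integral_add hlin hquad, integral_add (integrable_const 1)
          ((h.integrable hα hκ hξ.aestronglyMeasurable).const_mul l)]
        simp only [integral_const_mul, hmean, mul_zero, integral_const, probReal_univ, one_smul,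
          add_zero]
    _ ≤ l ^ 2 * (sqExpConst α κ * K) + 1 := by
        rw [add_comm]
        gcongr
        exact h.integral_exp_le
    _ ≤ _ := Real.add_one_le_exp _

lemma setOf_le_sum_subset_union {Ω ι : Type*} [Fintype ι] (ξ : ι → Ω → ℝ) (t : ℝ) :
    {ω | t ≤ ∑ i, ξ i ω} ⊆ {ω | t ≤ ∑ i, min (ξ i ω) t} ∪ ⋃ i, {ω | t ≤ ξ i ω} := by
  intro ω hω
  by_cases h : ∃ i, t ≤ ξ i ω
  · exact .inr (Set.mem_iUnion.2 h)
  · push Not at h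
    left
    simpa only [Set.mem_ofPred_eq, min_eq_left (h _).le] using hω

section Bernstein

variable {Ω ι : Type*} [MeasurableSpace Ω] {μ : Measure Ω} [IsProbabilityMeasure μ] [Fintype ι]
  {ξ : ι → Ω → ℝ} {α κ K : ℝ}

lemma measureReal_sum_min_ge_le_exp (hα : 0 < α) (hα1 : α ≤ 1) (hκ : 0 < κ)
    (hξ : ∀ i, Measurable (ξ i)) (hind : iIndepFun ξ μ) (hmean : ∀ i, ∫ ω, ξ i ω ∂μ = 0)
    (hexp : ∀ i, HasExpMomentLE (ξ i) α κ K μ) {l t : ℝ} (ht : 0 < t) (hl : 0 ≤ l)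
    (hlt : l * t ^ (1 - α) ≤ κ / 2) :
    μ.real {ω | t ≤ ∑ i, min (ξ i ω) t} ≤
      Real.exp (Fintype.card ι * (l ^ 2 * (sqExpConst α κ * K)) - l * t) := by
  have hmgf i := (hexp i).mgf_min_le hα hα1 hκ (hξ i) (hmean i) ht hl hlt
  have htrunc_meas i : Measurable fun ω => min (ξ i ω) t := (hξ i).min measurable_const
  have htrunc_ind : iIndepFun (fun i ω => min (ξ i ω) t) μ :=
    hind.comp (fun _ x => min x t) fun _ => measurable_id.min measurable_const
  have hchernoff := measure_ge_le_exp_mul_mgf (μ := μ) t hl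
    (htrunc_ind.integrable_exp_mul_sum htrunc_meas (s := Finset.univ) fun i _ => (hmgf i).1)
  rw [htrunc_ind.mgf_sum htrunc_meas] at hchernoff
  simp only [Finset.sum_apply] at hchernoff
  calc _ ≤ _ := hchernoff
    _ ≤ Real.exp (-l * t) * ∏ _i : ι, Real.exp (l ^ 2 * (sqExpConst α κ * K)) := by
        gcongr with i
        · exact fun i _ => mgf_nonneg
        · exact (hmgf i).2
    _ = _ := by
        rw [Finset.prod_const, ← Real.exp_nat_mul, Finset.card_univ, ← Real.exp_add]
        congr 1
        ring

/-- The choice `l = 2 c M / t` balances the two terms of the Chernoff exponent. -/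
lemma measureReal_sum_min_ge_le [Nonempty ι] (hα : 0 < α) (hα1 : α ≤ 1) (hκ : 0 < κ)
    (hξ : ∀ i, Measurable (ξ i)) (hind : iIndepFun ξ μ) (hmean : ∀ i, ∫ ω, ξ i ω ∂μ = 0)
    (hexp : ∀ i, HasExpMomentLE (ξ i) α κ K μ) {t : ℝ} (ht : 0 < t) :
    μ.real {ω | t ≤ ∑ i, min (ξ i ω) t} ≤
      Real.exp (-bernsteinRate α κ K * min (t ^ 2 / Fintype.card ι) (t ^ α)) := by
  have hK : 0 < K := (hexp (Classical.arbitrary ι)).pos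
  have hC := sqExpConst_pos hα hκ
  set N : ℝ := (Fintype.card ι : ℝ)
  have hN : 0 < N := by simp only [N]; exact_mod_cast Fintype.card_pos
  set c := bernsteinRate α κ K
  have hc : 0 < c := bernsteinRate_pos hα hκ hK
  set M := min (t ^ 2 / N) (t ^ α)
  have hM : 0 < M := by positivity
  have hlt : 2 * c * M / t * t ^ (1 - α) ≤ κ / 2 := by
    calc _ ≤ 2 * c * t ^ α / t * t ^ (1 - α) := by gcongr; exact min_le_right _ _
      _ = 2 * c * (t ^ α * t ^ (1 - α)) / t := by ring
      _ = 2 * c := by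
          rw [← Real.rpow_add ht, add_sub_cancel, Real.rpow_one, mul_div_cancel_right₀ _ ht.ne']
      _ ≤ κ / 2 := by linarith [show c ≤ κ / 4 from min_le_left _ _]
  refine (measureReal_sum_min_ge_le_exp hα hα1 hκ hξ hind hmean hexp ht (by positivity)
    hlt).trans (Real.exp_le_exp.2 ?_)
  have hvariance : N * ((2 * c * M / t) ^ 2 * (sqExpConst α κ * K)) ≤ c * M := by
    calc _ = 4 * (c * M) * (c * (sqExpConst α κ * K)) * (M / (t ^ 2 / N)) := by
          field_simp; ring
      _ ≤ 4 * (c * M) * (1 / 4) * 1 := by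
          gcongr
          · exact bernsteinRate_mul_le hα hκ hK
          · exact (div_le_one (by positivity)).2 (min_le_left _ _)
      _ = c * M := by ring
  have hlinear : 2 * c * M / t * t = 2 * (c * M) := by field_simp
  linarith

lemma measureReal_iUnion_ge_le (hα : 0 < α) (hκ : 0 < κ)
    (hexp : ∀ i, HasExpMomentLE (ξ i) α κ K μ) {t : ℝ} (ht : 0 ≤ t) :
    μ.real (⋃ i, {ω | t ≤ ξ i ω}) ≤ Fintype.card ι * K * Real.exp (-(κ * t ^ α)) := by
  calc _ ≤ ∑ i, μ.real {ω | t ≤ ξ i ω} := measureReal_iUnion_fintype_le _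
    _ ≤ ∑ _i : ι, K * Real.exp (-(κ * t ^ α)) :=
        Finset.sum_le_sum fun i _ => (hexp i).measureReal_ge_le hα hκ ht
    _ = _ := by rw [Finset.sum_const, Finset.card_univ, nsmul_eq_mul, mul_assoc]

theorem measureReal_card_mul_le_sum_le (hα : 0 < α) (hα1 : α ≤ 1) (hκ : 0 < κ)
    (hξ : ∀ i, Measurable (ξ i)) (hind : iIndepFun ξ μ) (hmean : ∀ i, ∫ ω, ξ i ω ∂μ = 0)
    (hexp : ∀ i, HasExpMomentLE (ξ i) α κ K μ) {ε : ℝ} (hε : 0 < ε) :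
    μ.real {ω | Fintype.card ι * ε ≤ ∑ i, ξ i ω} ≤
      bernsteinTail (bernsteinRate α κ K) α (Fintype.card ι) ε := by
  rcases isEmpty_or_nonempty ι with hι | hι
  · rw [Fintype.card_eq_zero, Nat.cast_zero, bernsteinTail_zero hα]
    exact measureReal_le_one.trans one_le_two
  have hK : 0 < K := (hexp (Classical.arbitrary ι)).pos
  set N : ℝ := (Fintype.card ι : ℝ)
  have hN : 0 < N := by simp only [N]; exact_mod_cast Fintype.card_pos
  set c := bernsteinRate α κ K
  have hc : 0 < c := bernsteinRate_pos hα hκ hK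
  set t := N * ε with ht
  have htpos : 0 < t := by positivity
  have hNε : N * ε ^ 2 = t ^ 2 / N := by rw [ht]; field_simp
  rw [bernsteinTail, ← ht, hNε]
  set M := min (t ^ 2 / N) (t ^ α)
  rcases le_or_gt (N * K) (Real.exp (κ / 2 * t ^ α)) with hlarge | hsmall
  · have hmax : μ.real (⋃ i, {ω | t ≤ ξ i ω}) ≤ Real.exp (-c * M) := by
      calc _ ≤ N * K * Real.exp (-(κ * t ^ α)) := measureReal_iUnion_ge_le hα hκ hexp htpos.le
        _ ≤ Real.exp (κ / 2 * t ^ α) * Real.exp (-(κ * t ^ α)) := by gcongr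
        _ = Real.exp (-(κ / 2) * t ^ α) := by rw [← Real.exp_add]; congr 1; ring
        _ ≤ Real.exp (-c * M) := by
            rw [neg_mul, neg_mul]
            gcongr
            · linarith [show c ≤ κ / 4 from min_le_left _ _]
            · exact min_le_right _ _
    calc _ ≤ _ := measureReal_mono (setOf_le_sum_subset_union ξ t)
      _ ≤ _ := measureReal_union_le _ _
      _ ≤ Real.exp (-c * M) + Real.exp (-c * M) :=
          add_le_add (measureReal_sum_min_ge_le hα hα1 hκ hξ hind hmean hexp htpos) hmax
      _ = _ := (two_mul _).symm
  · exact measureReal_le_one.trans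
      (one_le_two_mul_exp_neg_bernsteinRate_mul hα hκ hK hN htpos hsmall.le)

end Bernstein

/-! ### Weighted averages over independent rows -/

section WeightedAverage

variable {Ω 𝒳 ι ι' : Type*} [MeasurableSpace Ω] [MeasurableSpace 𝒳] [Fintype ι] [Fintype ι']
  {μ : Measure Ω} {ν : Measure 𝒳} {w : ι' → ℝ} {f : 𝒳 → ℝ} {α κ K : ℝ}

lemma integrable_mul_comp {g : Ω → 𝒳} {a : ℝ} (hg : a ≠ 0 → HasLaw g ν μ)
    (hf : Integrable f ν) : Integrable (fun ω => a * f (g ω)) μ := by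
  rcases eq_or_ne a 0 with rfl | ha
  · simp
  · exact (((hg ha).map_eq ▸ hf).comp_aemeasurable (hg ha).aemeasurable).const_mul a

lemma integral_sum_mul_comp {g : ι' → Ω → 𝒳} (hg : ∀ j, w j ≠ 0 → HasLaw (g j) ν μ)
    (hf : Integrable f ν) (hw1 : ∑ j, w j = 1) :
    ∫ ω, ∑ j, w j * f (g j ω) ∂μ = ∫ x, f x ∂ν := by
  have hterm (j : ι') : ∫ ω, w j * f (g j ω) ∂μ = w j * ∫ x, f x ∂ν := by
    rcases eq_or_ne (w j) 0 with hj | hj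
    · simp only [hj, zero_mul, integral_zero]
    · rw [integral_const_mul]
      exact congrArg (w j * ·) ((hg j hj).integral_comp hf.aestronglyMeasurable)
  rw [integral_finsetSum _ fun j _ => integrable_mul_comp (hg j) hf]
  simp only [hterm, ← Finset.sum_mul, hw1, one_mul]

lemma HasExpMomentLE.sum_mul_comp [IsProbabilityMeasure μ] (hf : HasExpMomentLE f α κ K ν)
    (hα : 0 < α) (hκ : 0 ≤ κ) (hf_meas : Measurable f) (hw : ∀ j, 0 ≤ w j) (hw1 : ∑ j, w j = 1)
    {g : ι' → Ω → 𝒳} (hg_meas : ∀ j, Measurable (g j)) (hg : ∀ j, w j ≠ 0 → HasLaw (g j) ν μ) :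
    HasExpMomentLE (fun ω => ∑ j, w j * f (g j ω)) α κ (Real.exp α⁻¹ + K) μ := by
  have hjensen (ω : Ω) : Real.exp (κ * |∑ j, w j * f (g j ω)| ^ α) ≤
      Real.exp α⁻¹ + ∑ j, w j * Real.exp (κ * |f (g j ω)| ^ α) := by
    have habs : |∑ j, w j * f (g j ω)| ≤ ∑ j, w j * |f (g j ω)| :=
      (Finset.abs_sum_le_sum_abs _ _).trans_eq
        (Finset.sum_congr rfl fun j _ => by rw [abs_mul, abs_of_nonneg (hw j)])
    refine le_trans ?_ (exp_mul_sum_rpow_le (κ := κ) hα hw hw1 fun j => abs_nonneg (f (g j ω)))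
    gcongr
  have hsum : Integrable (fun ω => ∑ j, w j * Real.exp (κ * |f (g j ω)| ^ α)) μ :=
    integrable_finsetSum _ fun j _ =>
      integrable_mul_comp (f := fun x => Real.exp (κ * |f x| ^ α)) (hg j) hf.integrable_exp
  have hdom := (integrable_const (Real.exp α⁻¹)).add hsum
  have hintg : Integrable (fun ω => Real.exp (κ * |∑ j, w j * f (g j ω)| ^ α)) μ := by
    refine hdom.mono' (Measurable.aestronglyMeasurable (by fun_prop)) (ae_of_all _ fun ω => ?_)
    rw [Real.norm_of_nonneg (Real.exp_pos _).le]
    exact hjensen ω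
  refine ⟨hintg, (integral_mono hintg hdom hjensen).trans ?_⟩
  simp only [Pi.add_apply]
  rw [integral_add (integrable_const _) hsum,
    integral_sum_mul_comp hg hf.integrable_exp hw1, integral_const, probReal_univ, one_smul]
  exact add_le_add_right hf.integral_exp_le _

/-- The entries of a row may be arbitrarily correlated, and the rate does not depend on the
weights. -/
theorem measureReal_card_mul_le_sum_sum_mul_le [IsProbabilityMeasure μ] (hα : 0 < α)
    (hα1 : α ≤ 1) (hκ : 0 < κ) (hf_meas : Measurable f) (hf_mean : ∫ x, f x ∂ν = 0)
    (hf : HasExpMomentLE f α κ K ν) (hw : ∀ j, 0 ≤ w j) (hw1 : ∑ j, w j = 1)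
    {G : ι → ι' → Ω → 𝒳} (hG_meas : ∀ i j, Measurable (G i j))
    (hG : ∀ i j, w j ≠ 0 → HasLaw (G i j) ν μ) (hG_ind : iIndepFun (fun i ω j => G i j ω) μ)
    {ε : ℝ} (hε : 0 < ε) :
    μ.real {ω | Fintype.card ι * ε ≤ ∑ i, ∑ j, w j * f (G i j ω)} ≤
      bernsteinTail (bernsteinRate α κ (Real.exp α⁻¹ + K)) α (Fintype.card ι) ε := by
  refine measureReal_card_mul_le_sum_le hα hα1 hκ (ξ := fun i ω => ∑ j, w j * f (G i j ω))
    (fun i => by fun_prop) ?_ (fun i => ?_)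
    (fun i => hf.sum_mul_comp hα hκ.le hf_meas hw hw1 (hG_meas i) (hG i)) hε
  · exact hG_ind.comp (fun _ (x : ι' → 𝒳) => ∑ j, w j * f (x j)) fun _ => by fun_prop
  · obtain ⟨j, hj⟩ : ∃ j, w j ≠ 0 := by
      by_contra! hw0
      simp [hw0] at hw1
    have : IsProbabilityMeasure ν := (hG i j hj).isProbabilityMeasure_iff.1 inferInstance
    rw [integral_sum_mul_comp (hG i) (hf.integrable hα hκ hf_meas.aestronglyMeasurable) hw1,
      hf_mean]

end WeightedAverage

/-- The rate in the concentration of weighted averages of `h γ`, with `γ` standard Gaussian and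
`|h x| ≤ B (1 + x ^ 2) ^ α⁻¹`. -/
noncomputable def gaussianRate (α B : ℝ) : ℝ :=
  bernsteinRate α (1 / (4 * B ^ α))
    (Real.exp α⁻¹ + ∫ x, Real.exp ((1 + x ^ 2) / 4) ∂(gaussianReal 0 1))

lemma integrable_exp_one_add_sq_div_four :
    Integrable (fun x : ℝ => Real.exp ((1 + x ^ 2) / 4)) (gaussianReal 0 1) := by
  rw [gaussianReal_of_var_ne_zero 0 one_ne_zero,
    integrable_withDensity_iff_integrable_smul' (measurable_gaussianPDF 0 1)
      (ae_of_all _ fun x => gaussianPDF_lt_top)]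
  refine ((integrable_exp_neg_mul_sq (b := 1 / 4) (by norm_num)).const_mul
    ((√(2 * Real.pi * (1 : ℝ≥0)))⁻¹ * Real.exp (1 / 4))).congr (ae_of_all _ fun x => ?_)
  simp only [toReal_gaussianPDF, gaussianPDFReal, smul_eq_mul, NNReal.coe_one]
  rw [mul_assoc _ (Real.exp _), mul_assoc _ (Real.exp _), ← Real.exp_add, ← Real.exp_add]
  congr 2
  ring

lemma gaussianRate_pos {α B : ℝ} (hα : 0 < α) (hB : 0 < B) : 0 < gaussianRate α B := by
  have := integral_exp_pos integrable_exp_one_add_sq_div_four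
  exact bernsteinRate_pos hα (by positivity) (by positivity)

lemma hasExpMomentLE_gaussianReal {α B : ℝ} (hα : 0 < α) (hB : 0 < B) {h : ℝ → ℝ}
    (h_meas : Measurable h) (h_le : ∀ x, |h x| ≤ B * (1 + x ^ 2) ^ α⁻¹) :
    HasExpMomentLE h α (1 / (4 * B ^ α)) (∫ x, Real.exp ((1 + x ^ 2) / 4) ∂(gaussianReal 0 1))
      (gaussianReal 0 1) := by
  have hexp_le (x : ℝ) :
      Real.exp (1 / (4 * B ^ α) * |h x| ^ α) ≤ Real.exp ((1 + x ^ 2) / 4) := by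
    refine Real.exp_le_exp.2 ?_
    calc 1 / (4 * B ^ α) * |h x| ^ α
        ≤ 1 / (4 * B ^ α) * (B * (1 + x ^ 2) ^ α⁻¹) ^ α := by gcongr; exact h_le x
      _ = (1 + x ^ 2) / 4 := by
        rw [Real.mul_rpow hB.le (by positivity), Real.rpow_inv_rpow (by positivity) hα.ne']
        field_simp
  have hintg : Integrable (fun x => Real.exp (1 / (4 * B ^ α) * |h x| ^ α)) (gaussianReal 0 1) := by
    refine integrable_exp_one_add_sq_div_four.mono'
      (Measurable.aestronglyMeasurable (by fun_prop)) (ae_of_all _ fun x => ?_)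
    rw [Real.norm_of_nonneg (Real.exp_pos _).le]
    exact hexp_le x
  exact ⟨hintg, integral_mono hintg integrable_exp_one_add_sq_div_four hexp_le⟩

lemma abs_div_sub_one_le {α r B M : ℝ} (hα : 0 < α) (hr : 0 < r) (hαr : α ≤ 2 / r) {f : ℝ → ℝ}
    (hf : ∀ x, |f x| ≤ B * |x| ^ r) (x : ℝ) :
    |f x / M - 1| ≤ (B / |M| + 1) * (1 + x ^ 2) ^ α⁻¹ := by
  have hB : 0 ≤ B := by simpa using (abs_nonneg _).trans (hf 1)
  have hpow : |x| ^ r ≤ (1 + x ^ 2) ^ α⁻¹ := by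
    calc |x| ^ r = (x ^ 2) ^ (r / 2) := by
          rw [← sq_abs, ← Real.rpow_natCast_mul (abs_nonneg x)]; congr 1; push_cast; ring
      _ ≤ (1 + x ^ 2) ^ (r / 2) := by gcongr; linarith
      _ ≤ (1 + x ^ 2) ^ α⁻¹ := by
          refine Real.rpow_le_rpow_of_exponent_le (by linarith [sq_nonneg x]) ?_
          rw [← inv_div]
          exact inv_anti₀ hα hαr
  have hone : 1 ≤ (1 + x ^ 2) ^ α⁻¹ :=
    Real.one_le_rpow (by linarith [sq_nonneg x]) (inv_pos.2 hα).le
  calc |f x / M - 1| ≤ |f x| / |M| + 1 := by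
        simpa only [abs_div, abs_one] using abs_sub (f x / M) 1
    _ ≤ B * (1 + x ^ 2) ^ α⁻¹ / |M| + 1 * (1 + x ^ 2) ^ α⁻¹ := by
        rw [one_mul]
        gcongr
        exact (hf x).trans (by gcongr)
    _ = _ := by ring

section ScaledGaussian

variable {Ω ι ι' : Type*} [MeasurableSpace Ω] [Fintype ι] [Fintype ι'] {μ : Measure Ω}
  [IsProbabilityMeasure μ] {α : ℝ} {u : ι' → ℝ} {G : ι → ι' → Ω → ℝ}

lemma measureReal_card_mul_le_sum_sum_gaussianReal_le (hα : 0 < α) (hα1 : α ≤ 1) {B : ℝ}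
    (hB : 0 < B) {h : ℝ → ℝ} (h_meas : Measurable h) (h_mean : ∫ x, h x ∂(gaussianReal 0 1) = 0)
    (h_le : ∀ x, |h x| ≤ B * (1 + x ^ 2) ^ α⁻¹) (hu : 0 < ∑ j, u j ^ 2)
    (hG_meas : ∀ i j, Measurable (G i j))
    (hG : ∀ i j, u j ≠ 0 → HasLaw (G i j) (gaussianReal 0 1) μ)
    (hG_ind : iIndepFun (fun i ω j => G i j ω) μ) {ε : ℝ} (hε : 0 < ε) :
    μ.real {ω | Fintype.card ι * ε * ∑ j, u j ^ 2 ≤ ∑ i, ∑ j, u j ^ 2 * h (G i j ω)} ≤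
      bernsteinTail (gaussianRate α B) α (Fintype.card ι) ε := by
  refine le_trans (measureReal_mono fun ω hω => ?_)
    (measureReal_card_mul_le_sum_sum_mul_le (w := fun j => u j ^ 2 / ∑ j, u j ^ 2) hα hα1
      (by positivity) h_meas h_mean (hasExpMomentLE_gaussianReal hα hB h_meas h_le)
      (fun j => by positivity) (by rw [← Finset.sum_div, div_self hu.ne']) hG_meas
      (fun i j hj => hG i j fun huj => hj (by simp [huj])) hG_ind hε)
  simp only [Set.mem_ofPred_eq, div_mul_eq_mul_div, ← Finset.sum_div] at hω ⊢
  rwa [le_div_iff₀ hu]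

variable {r B M : ℝ} {f : ℝ → ℝ}

lemma integral_div_sub_one_eq_zero (hM : ∫ x, f x ∂(gaussianReal 0 1) = M) (hM0 : M ≠ 0) :
    ∫ x, (f x / M - 1) ∂(gaussianReal 0 1) = 0 := by
  have hf : Integrable f (gaussianReal 0 1) := .of_integral_ne_zero (hM ▸ hM0)
  rw [integral_sub (hf.div_const M) (integrable_const 1), integral_div, hM, div_self hM0]
  simp

lemma sum_sum_mul_div_sub_one (u : ι' → ℝ) (F : ι → ι' → ℝ) (M : ℝ) :
    ∑ i, ∑ j, u j ^ 2 * (F i j / M - 1) =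
      (∑ i, ∑ j, u j ^ 2 * F i j) / M - Fintype.card ι * ∑ j, u j ^ 2 := by
  simp only [mul_sub, mul_one, Finset.sum_sub_distrib, Finset.sum_const, Finset.card_univ,
    nsmul_eq_mul, mul_div_assoc', Finset.sum_div]

lemma measureReal_one_add_mul_le_sum_sum_le (hα : 0 < α) (hα1 : α ≤ 1) (hr : 0 < r)
    (hαr : α ≤ 2 / r) (hf_meas : Measurable f) (hf : ∀ x, |f x| ≤ B * |x| ^ r)
    (hM : ∫ x, f x ∂(gaussianReal 0 1) = M) (hM0 : M ≠ 0) (hu : 0 < ∑ j, u j ^ 2)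
    (hG_meas : ∀ i j, Measurable (G i j))
    (hG : ∀ i j, u j ≠ 0 → HasLaw (G i j) (gaussianReal 0 1) μ)
    (hG_ind : iIndepFun (fun i ω j => G i j ω) μ) {ε : ℝ} (hε : 0 < ε) :
    μ.real {ω | (1 + ε) * (Fintype.card ι * ∑ j, u j ^ 2) ≤
        (∑ i, ∑ j, u j ^ 2 * f (G i j ω)) / M} ≤
      bernsteinTail (gaussianRate α (B / |M| + 1)) α (Fintype.card ι) ε := by
  have hB : 0 ≤ B := by simpa using (abs_nonneg _).trans (hf 1)
  refine le_trans (measureReal_mono fun ω hω => ?_)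
    (measureReal_card_mul_le_sum_sum_gaussianReal_le hα hα1 (by positivity)
      (h := fun x => f x / M - 1) (by fun_prop) (integral_div_sub_one_eq_zero hM hM0)
      (abs_div_sub_one_le hα hr hαr hf) hu hG_meas hG hG_ind hε)
  simp only [Set.mem_ofPred_eq] at hω ⊢
  rw [sum_sum_mul_div_sub_one]
  linarith

lemma measureReal_sum_sum_le_one_sub_mul_le (hα : 0 < α) (hα1 : α ≤ 1) (hr : 0 < r)
    (hαr : α ≤ 2 / r) (hf_meas : Measurable f) (hf : ∀ x, |f x| ≤ B * |x| ^ r)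
    (hM : ∫ x, f x ∂(gaussianReal 0 1) = M) (hM0 : M ≠ 0) (hu : 0 < ∑ j, u j ^ 2)
    (hG_meas : ∀ i j, Measurable (G i j))
    (hG : ∀ i j, u j ≠ 0 → HasLaw (G i j) (gaussianReal 0 1) μ)
    (hG_ind : iIndepFun (fun i ω j => G i j ω) μ) {ε : ℝ} (hε : 0 < ε) :
    μ.real {ω | (∑ i, ∑ j, u j ^ 2 * f (G i j ω)) / M ≤
        (1 - ε) * (Fintype.card ι * ∑ j, u j ^ 2)} ≤
      bernsteinTail (gaussianRate α (B / |M| + 1)) α (Fintype.card ι) ε := by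
  have hB : 0 ≤ B := by simpa using (abs_nonneg _).trans (hf 1)
  refine le_trans (measureReal_mono fun ω hω => ?_)
    (measureReal_card_mul_le_sum_sum_gaussianReal_le hα hα1 (by positivity)
      (h := fun x => -(f x / M - 1)) (by fun_prop)
      (by rw [integral_neg, integral_div_sub_one_eq_zero hM hM0, neg_zero])
      (fun x => (abs_neg _).trans_le (abs_div_sub_one_le hα hr hαr hf x))
      hu hG_meas hG hG_ind hε)
  simp only [Set.mem_ofPred_eq, mul_neg, Finset.sum_neg_distrib] at hω ⊢
  rw [sum_sum_mul_div_sub_one]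
  linarith

end ScaledGaussian

/-! ### Positively homogeneous activations -/

/-- The `p`-homogeneous function with values `s₁` at `1` and `s₂` at `-1`. -/
noncomputable def signedPower (p s₁ s₂ t : ℝ) : ℝ := |t| ^ p * if 0 ≤ t then s₁ else s₂

lemma measurable_signedPower (p s₁ s₂ : ℝ) : Measurable (signedPower p s₁ s₂) :=
  (measurable_id.abs.pow_const p).mul
    (Measurable.ite measurableSet_Ici measurable_const measurable_const)

namespace IsPosHomogeneous

variable {p : ℝ} {σ : ℝ → ℝ}

lemma eq_signedPower (hσ : IsPosHomogeneous p σ) : σ = signedPower p (σ 1) (σ (-1)) := by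
  ext t
  rw [signedPower]
  split_ifs with ht
  · rw [← hσ |t| 1 (abs_nonneg t), abs_of_nonneg ht, mul_one]
  · rw [← hσ |t| (-1) (abs_nonneg t), abs_of_neg (not_le.1 ht), neg_mul_neg, mul_one]

lemma measurable (hσ : IsPosHomogeneous p σ) : Measurable σ :=
  hσ.eq_signedPower ▸ measurable_signedPower _ _ _

lemma abs_le (hσ : IsPosHomogeneous p σ) (t : ℝ) :
    |σ t| ≤ (|σ 1| + |σ (-1)|) * |t| ^ p := by
  rw [congrFun hσ.eq_signedPower t, signedPower, abs_mul, mul_comm,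
    abs_of_nonneg (by positivity : 0 ≤ |t| ^ p)]
  gcongr
  split_ifs <;> linarith [abs_nonneg (σ 1), abs_nonneg (σ (-1))]

lemma sq_abs_le (hσ : IsPosHomogeneous p σ) (t : ℝ) :
    |σ t ^ 2| ≤ (|σ 1| + |σ (-1)|) ^ 2 * |t| ^ (2 * p) := by
  calc |σ t ^ 2| = |σ t| ^ 2 := abs_pow _ _
    _ ≤ ((|σ 1| + |σ (-1)|) * |t| ^ p) ^ 2 := by gcongr; exact hσ.abs_le t
    _ = _ := by rw [mul_pow, mul_comm 2 p, Real.rpow_mul (abs_nonneg t), Real.rpow_two]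

lemma map_zero (hσ : IsPosHomogeneous p σ) (hp : p ≠ 0) : σ 0 = 0 := by
  simpa [Real.zero_rpow hp] using hσ 0 0 le_rfl

lemma apply_eq_rpow_mul (hσ : IsPosHomogeneous p σ) (hp : p ≠ 0) {r t : ℝ} (hr : 0 ≤ r)
    (ht : r = 0 → t = 0) : σ t = r ^ p * σ (t / r) := by
  rcases eq_or_ne r 0 with hr0 | hr0
  · rw [ht hr0, hσ.map_zero hp, hr0, Real.zero_rpow hp, zero_mul]
  · rw [← hσ r _ hr, mul_div_cancel₀ _ hr0]

end IsPosHomogeneous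

lemma integrable_of_abs_le_rpow {r B : ℝ} (hr : 0 < r) {f : ℝ → ℝ} (hf_meas : Measurable f)
    (hf : ∀ x, |f x| ≤ B * |x| ^ r) : Integrable f (gaussianReal 0 1) := by
  have hB : 0 ≤ B := by simpa using (abs_nonneg _).trans (hf 1)
  refine (integrable_exp_one_add_sq_div_four.const_mul
    (B * (r / (2 * (1 / 4))) ^ (r / 2))).mono' hf_meas.aestronglyMeasurable
    (ae_of_all _ fun x => (hf x).trans ?_)
  rw [mul_assoc]
  gcongr
  calc |x| ^ r ≤ (r / (2 * (1 / 4))) ^ (r / 2) * Real.exp (1 / 4 * |x| ^ (2 : ℝ)) :=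
        rpow_le_mul_exp_rpow two_pos (by norm_num) hr (abs_nonneg x)
    _ ≤ _ := by
        rw [Real.rpow_two, sq_abs]
        gcongr
        linarith

lemma integral_sq_pos {𝒳 : Type*} [MeasurableSpace 𝒳] {ν : Measure 𝒳} {f : 𝒳 → ℝ}
    (hf_sq : Integrable (fun x => f x ^ 2) ν) (hf : ∫ x, f x ∂ν ≠ 0) :
    0 < ∫ x, f x ^ 2 ∂ν := by
  refine (integral_nonneg fun x => sq_nonneg (f x)).lt_of_ne' fun hzero => hf ?_
  rw [integral_eq_zero_iff_of_nonneg (fun x => sq_nonneg (f x)) hf_sq] at hzero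
  exact integral_eq_zero_of_ae (hzero.mono fun x hx => pow_eq_zero_iff two_ne_zero |>.1 hx)

/-! ### Gaussian matrices -/

section GaussianMatrix

variable {Ω ι κ τ : Type*} [MeasurableSpace Ω] {μ : Measure Ω} {v : ℝ≥0}

lemma hasLaw_sum_mul_gaussianReal [IsProbabilityMeasure μ] [Fintype κ] {g : κ → Ω → ℝ}
    (hg : ∀ k, HasLaw (g k) (gaussianReal 0 v) μ) (hg_ind : iIndepFun g μ) (a : κ → ℝ) :
    HasLaw (fun ω => ∑ k, g k ω * a k) (gaussianReal 0 (v * ∑ k, a k ^ 2).toNNReal) μ := by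
  have hlaw k := gaussianReal_mul_const (hg k) (a k)
  have hgauss k := (hlaw k).hasGaussianLaw
  have hind : iIndepFun (fun k ω => g k ω * a k) μ :=
    hg_ind.comp (fun k x => x * a k) fun k => measurable_id.mul_const _
  have hsum := iIndepFun.hasGaussianLaw_fun_sum hgauss hind
  refine ⟨hsum.aemeasurable, ?_⟩
  rw [hsum.map_eq_gaussianReal]
  congr 2
  · rw [integral_finsetSum _ fun k _ => (hgauss k).memLp_two.integrable (by norm_num)]
    exact Finset.sum_eq_zero fun k _ => by rw [(hlaw k).integral_eq]; simp
  · rw [← Finset.sum_fn, IndepFun.variance_sum (fun k _ => (hgauss k).memLp_two)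
      fun i _ j _ hij => hind.indepFun hij, Finset.mul_sum]
    exact Finset.sum_congr rfl fun k _ => by rw [(hlaw k).variance_eq]; simp [mul_comm]

/-- A random matrix with independent `N(0, v)` entries. -/
structure IsGaussianMatrix (V : Ω → Matrix ι κ ℝ) (v : ℝ≥0) (μ : Measure Ω) : Prop where
  measurable : ∀ i k, Measurable fun ω => V ω i k
  hasLaw : ∀ i k, HasLaw (fun ω => V ω i k) (gaussianReal 0 v) μ
  indep : iIndepFun (fun (x : ι × κ) ω => V ω x.1 x.2) μ

/-- The standard deviation of the entries in column `j` of `V * a`, for a matrix `V` with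
independent entries of variance `v`. -/
noncomputable def columnStd [Fintype κ] (v : ℝ≥0) (a : Matrix κ τ ℝ) (j : τ) : ℝ :=
  √(v * ∑ k, a k j ^ 2)

section ColumnStd

variable [Fintype κ] {a : Matrix κ τ ℝ}

lemma columnStd_eq_zero_iff (hv : v ≠ 0) {j : τ} : columnStd v a j = 0 ↔ ∀ k, a k j = 0 := by
  have : 0 ≤ ∑ k, a k j ^ 2 := by positivity
  rw [columnStd, Real.sqrt_eq_zero (by positivity), mul_eq_zero,
    Finset.sum_eq_zero_iff_of_nonneg fun k _ => sq_nonneg _]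
  simp [hv]

lemma sum_columnStd_rpow_sq_pos [Fintype τ] (hv : v ≠ 0) (ha : a ≠ 0) (p : ℝ) :
    0 < ∑ j, (columnStd v a j ^ p) ^ 2 := by
  obtain ⟨j, hj⟩ : ∃ j, columnStd v a j ≠ 0 := by
    by_contra! hzero
    exact ha (Matrix.ext fun k j => (columnStd_eq_zero_iff hv).1 (hzero j) k)
  have hpos : 0 < columnStd v a j ^ p :=
    Real.rpow_pos_of_pos ((Real.sqrt_nonneg _).lt_of_ne' hj) p
  exact Finset.sum_pos' (fun j _ => sq_nonneg _) ⟨j, Finset.mem_univ j, by positivity⟩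

end ColumnStd

namespace IsGaussianMatrix

variable {V : Ω → Matrix ι κ ℝ}

lemma measurable_mul [Fintype κ] (hV : IsGaussianMatrix V v μ) (a : Matrix κ τ ℝ) (i : ι) (j : τ) :
    Measurable fun ω => (V ω * a) i j := by
  simp only [Matrix.mul_apply]
  exact Finset.measurable_fun_sum _ fun k _ => (hV.measurable i k).mul_const _

lemma hasLaw_mul_div_columnStd [IsProbabilityMeasure μ] [Fintype κ] (hV : IsGaussianMatrix V v μ)
    (a : Matrix κ τ ℝ) (i : ι) {j : τ} (hj : columnStd v a j ≠ 0) :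
    HasLaw (fun ω => (V ω * a) i j / columnStd v a j) (gaussianReal 0 1) μ := by
  have hrow : iIndepFun (fun k ω => V ω i k) μ :=
    hV.indep.precomp (g := fun k => (i, k)) fun k l hkl => (Prod.mk.inj hkl).2
  have hpos : 0 ≤ (v : ℝ) * ∑ k, a k j ^ 2 := by positivity
  convert gaussianReal_div_const (hasLaw_sum_mul_gaussianReal (hV.hasLaw i) hrow fun k => a k j)
    (columnStd v a j) using 1
  · simp [Matrix.mul_apply]
  · have hsq : columnStd v a j ^ 2 = v * ∑ k, a k j ^ 2 := Real.sq_sqrt hpos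
    rw [← hsq, zero_div]
    congr 1
    ext
    simp [max_eq_left (sq_nonneg (columnStd v a j)), hj]

lemma iIndepFun_rows [Finite ι] [Finite κ] (hV : IsGaussianMatrix V v μ) :
    iIndepFun (fun i ω => V ω i) μ := by
  cases nonempty_fintype ι
  cases nonempty_fintype κ
  have hentry (x : ι × κ) : HasGaussianLaw (fun ω => V ω x.1 x.2) μ :=
    (hV.hasLaw x.1 x.2).hasGaussianLaw
  have hjoint : HasGaussianLaw (fun ω i k => V ω i k) μ :=
    (iIndepFun.hasGaussianLaw hentry hV.indep).map
      (ContinuousLinearMap.pi fun i => ContinuousLinearMap.pi fun k =>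
        ContinuousLinearMap.proj (R := ℝ) (φ := fun _ : ι × κ => ℝ) (i, k))
  refine HasGaussianLaw.iIndepFun_of_covariance_eval (X := fun i k ω => V ω i k) hjoint ?_
  intro i j hij k l
  have hne : (i, k) ≠ (j, l) := fun h => hij (congrArg Prod.fst h)
  exact (hV.indep.indepFun hne).covariance_eq_zero (hentry (i, k)).memLp_two
    (hentry (j, l)).memLp_two

lemma iIndepFun_mul_div_columnStd [Finite ι] [Fintype κ] (hV : IsGaussianMatrix V v μ)
    (a : Matrix κ τ ℝ) :
    iIndepFun (fun i ω j => (V ω * a) i j / columnStd v a j) μ :=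
  hV.iIndepFun_rows.comp (fun _ x j => (∑ k, x k * a k j) / columnStd v a j) fun _ => by
    fun_prop

end IsGaussianMatrix

end GaussianMatrix

/-! ### One random layer -/

lemma frobNorm_sq {m n : ℕ} (A : Matrix (Fin m) (Fin n) ℝ) :
    frobNorm A ^ 2 = ∑ i, ∑ j, A i j ^ 2 := by
  rw [frobNorm, Matrix.frobenius_norm_def]
  simp only [Real.rpow_two, Real.norm_eq_abs, sq_abs]
  rw [← Real.sqrt_eq_rpow, Real.sq_sqrt (by positivity)]

lemma stableRank_zero {m n : ℕ} : stableRank (0 : Matrix (Fin m) (Fin n) ℝ) = 0 := by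
  simp [stableRank, frobNorm_sq]

lemma sq_sum_mul_le_opNorm_sq {m n : ℕ} (A : Matrix (Fin m) (Fin n) ℝ) (u : Fin n → ℝ) :
    (∑ i, ∑ j, u j * A i j) ^ 2 ≤ opNorm A ^ 2 * (m * ∑ j, u j ^ 2) := by
  have hrow i : ∑ j, u j * A i j = (A.mulVec u) i := by
    simp only [Matrix.mulVec, dotProduct, mul_comm]
  have hnorm : ‖WithLp.toLp 2 (A.mulVec u)‖ ≤ opNorm A * ‖WithLp.toLp 2 u‖ :=
    Matrix.l2_opNorm_mulVec A (WithLp.toLp 2 u)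
  calc (∑ i, ∑ j, u j * A i j) ^ 2 = (∑ i, (A.mulVec u) i) ^ 2 := by simp_rw [hrow]
    _ ≤ m * ∑ i, (A.mulVec u) i ^ 2 := by
        simpa using sq_sum_le_card_mul_sum_sq (s := Finset.univ) (f := A.mulVec u)
    _ = m * ‖WithLp.toLp 2 (A.mulVec u)‖ ^ 2 := by simp [EuclideanSpace.norm_sq_eq]
    _ ≤ m * (opNorm A * ‖WithLp.toLp 2 u‖) ^ 2 := by gcongr
    _ = opNorm A ^ 2 * (m * ∑ j, u j ^ 2) := by
        simp only [mul_pow, EuclideanSpace.norm_sq_eq, Real.norm_eq_abs, sq_abs]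
        ring

lemma stableRank_le_of_sum_mul_ne_zero {m n : ℕ} {A : Matrix (Fin m) (Fin n) ℝ} {u : Fin n → ℝ}
    (hu : ∑ i, ∑ j, u j * A i j ≠ 0) :
    stableRank A ≤ frobNorm A ^ 2 * (m * ∑ j, u j ^ 2) / (∑ i, ∑ j, u j * A i j) ^ 2 := by
  have hle := sq_sum_mul_le_opNorm_sq A u
  have hsq : 0 < (∑ i, ∑ j, u j * A i j) ^ 2 := by positivity
  have hop : 0 < opNorm A ^ 2 :=
    pos_of_mul_pos_left (hsq.trans_le hle) (by positivity)
  rw [stableRank, div_le_div_iff₀ hop hsq, mul_assoc, mul_comm _ (opNorm A ^ 2)]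
  gcongr

/-- The stable rank bound `(1 + ε₁) / (1 - ε₂)² · m₂ / m₁²`, with `m₁` and `m₂` the first two
moments of `σ` under the standard Gaussian measure. -/
noncomputable def stableRankBound (σ : ℝ → ℝ) (ε₁ ε₂ : ℝ) : ℝ :=
  (1 + ε₁) / (1 - ε₂) ^ 2 *
    ((∫ t, σ t ^ 2 ∂(gaussianReal 0 1)) / (∫ t, σ t ∂(gaussianReal 0 1)) ^ 2)

lemma stableRank_le_stableRankBound {m n : ℕ} {A : Matrix (Fin m) (Fin n) ℝ} {u : Fin n → ℝ}
    {σ : ℝ → ℝ} (hσ : ∫ t, σ t ∂(gaussianReal 0 1) ≠ 0)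
    (hσ_sq : 0 < ∫ t, σ t ^ 2 ∂(gaussianReal 0 1)) {ε₁ ε₂ : ℝ} (hε₂ : ε₂ < 1)
    (hu : 0 < m * ∑ j, u j ^ 2)
    (hfrob : frobNorm A ^ 2 / ∫ t, σ t ^ 2 ∂(gaussianReal 0 1) < (1 + ε₁) * (m * ∑ j, u j ^ 2))
    (hsum : (1 - ε₂) * (m * ∑ j, u j ^ 2) <
      (∑ i, ∑ j, u j * A i j) / ∫ t, σ t ∂(gaussianReal 0 1)) :
    A ≠ 0 ∧ stableRank A ≤ stableRankBound σ ε₁ ε₂ := by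
  unfold stableRankBound
  set m₁ := ∫ t, σ t ∂(gaussianReal 0 1)
  set m₂ := ∫ t, σ t ^ 2 ∂(gaussianReal 0 1)
  set q := m * ∑ j, u j ^ 2
  have hε₂' : 0 < 1 - ε₂ := sub_pos.2 hε₂
  have hsum_ne : ∑ i, ∑ j, u j * A i j ≠ 0 := fun h => by
    rw [h, zero_div] at hsum
    exact hsum.not_ge (by positivity)
  refine ⟨fun h => hsum_ne (by simp [h]), (stableRank_le_of_sum_mul_ne_zero hsum_ne).trans ?_⟩
  have hsum_sq : ((1 - ε₂) * q * m₁) ^ 2 ≤ (∑ i, ∑ j, u j * A i j) ^ 2 := by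
    rw [← div_mul_cancel₀ (∑ i, ∑ j, u j * A i j) hσ, mul_pow, mul_pow _ m₁]
    gcongr
  rw [div_lt_iff₀ hσ_sq] at hfrob
  have hfrob_nonneg : 0 ≤ (1 + ε₁) * q * m₂ := (sq_nonneg _).trans hfrob.le
  calc frobNorm A ^ 2 * q / (∑ i, ∑ j, u j * A i j) ^ 2
      ≤ ((1 + ε₁) * q * m₂) * q / ((1 - ε₂) * q * m₁) ^ 2 := by gcongr
    _ = (1 + ε₁) / (1 - ε₂) ^ 2 * (m₂ / m₁ ^ 2) := by field_simp

/-- Multiplication by `V` followed by `σ` maps `a` to a matrix of stable rank at most `R`, which is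
nonzero if `a` is. There is no condition when `a = 0`. -/
def IsStableLayer {N d n : ℕ} (σ : ℝ → ℝ) (R : ℝ) (V : Matrix (Fin N) (Fin d) ℝ)
    (a : Matrix (Fin d) (Fin n) ℝ) : Prop :=
  a ≠ 0 → (V * a).map σ ≠ 0 ∧ stableRank ((V * a).map σ) ≤ R

/-- The common exponential rate of the two deviation bounds for a layer with activation `σ`: that
of `σ(γ)`, with tail exponent `min 1 (2 / p)`, and that of `σ(γ) ^ 2`, with tail exponent
`min 1 (1 / p)`, where `γ` is a standard Gaussian. -/
noncomputable def layerRate (p : ℝ) (σ : ℝ → ℝ) : ℝ :=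
  min (gaussianRate (min 1 (2 / p))
      ((|σ 1| + |σ (-1)|) / |∫ t, σ t ∂(gaussianReal 0 1)| + 1))
    (gaussianRate (min 1 (1 / p))
      ((|σ 1| + |σ (-1)|) ^ 2 / |∫ t, σ t ^ 2 ∂(gaussianReal 0 1)| + 1))

lemma layerRate_pos {p : ℝ} (hp : 0 < p) (σ : ℝ → ℝ) : 0 < layerRate p σ :=
  lt_min (gaussianRate_pos (by positivity) (by positivity))
    (gaussianRate_pos (by positivity) (by positivity))

/-- The bound on the probability that a layer of width `N` is not stable. -/
noncomputable def layerTail (c p N ε₁ ε₂ : ℝ) : ℝ :=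
  bernsteinTail c (min 1 (2 / p)) N ε₂ + bernsteinTail c (min 1 (1 / p)) N ε₁

section Layer

variable {Ω : Type*} [MeasurableSpace Ω] {μ : Measure Ω} [IsProbabilityMeasure μ] {N d n : ℕ}
  {v : ℝ≥0} {V : Ω → Matrix (Fin N) (Fin d) ℝ} {a : Matrix (Fin d) (Fin n) ℝ} {p : ℝ} {σ : ℝ → ℝ}

lemma IsPosHomogeneous.map_mul_apply (hσ : IsPosHomogeneous p σ) (hp : p ≠ 0) (hv : v ≠ 0)
    (V : Matrix (Fin N) (Fin d) ℝ) (a : Matrix (Fin d) (Fin n) ℝ) (i : Fin N) (j : Fin n) :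
    ((V * a).map σ) i j = columnStd v a j ^ p * σ ((V * a) i j / columnStd v a j) := by
  refine hσ.apply_eq_rpow_mul hp (Real.sqrt_nonneg _) fun hzero => ?_
  rw [Matrix.mul_apply]
  exact Finset.sum_eq_zero fun k _ => by rw [(columnStd_eq_zero_iff hv).1 hzero k, mul_zero]

namespace IsGaussianMatrix

lemma measureReal_frobNorm_sq_ge_le (hV : IsGaussianMatrix V v μ) (hp : 0 < p)
    (hσ : IsPosHomogeneous p σ) (hσ_sq : ∫ t, σ t ^ 2 ∂(gaussianReal 0 1) ≠ 0) (hv : v ≠ 0)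
    (ha : a ≠ 0) {ε : ℝ} (hε : 0 < ε) :
    μ.real {ω | (1 + ε) * (N * ∑ j, (columnStd v a j ^ p) ^ 2) ≤
        frobNorm ((V ω * a).map σ) ^ 2 / ∫ t, σ t ^ 2 ∂(gaussianReal 0 1)} ≤
      bernsteinTail (layerRate p σ) (min 1 (1 / p)) N ε := by
  have hexp : min 1 (1 / p) ≤ 2 / (2 * p) :=
    (min_le_right _ _).trans_eq (mul_div_mul_left 1 p two_ne_zero ▸ by rw [mul_one])
  have htail := measureReal_one_add_mul_le_sum_sum_le (α := min 1 (1 / p)) (by positivity)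
    (min_le_left _ _) (by positivity) hexp (hσ.measurable.pow_const 2) hσ.sq_abs_le rfl hσ_sq
    (sum_columnStd_rpow_sq_pos hv ha p)
    (fun i j => (hV.measurable_mul a i j).div_const (columnStd v a j))
    (fun i j hj => hV.hasLaw_mul_div_columnStd a i fun h => hj (by rw [h, Real.zero_rpow hp.ne']))
    (hV.iIndepFun_mul_div_columnStd a) hε
  simp only [← mul_pow, ← hσ.map_mul_apply hp.ne' hv, ← frobNorm_sq, Fintype.card_fin] at htail
  exact htail.trans (bernsteinTail_anti N.cast_nonneg hε.le (min_le_right _ _))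

lemma measureReal_sum_columnStd_mul_le_le (hV : IsGaussianMatrix V v μ) (hp : 0 < p)
    (hσ : IsPosHomogeneous p σ) (hσ_mean : ∫ t, σ t ∂(gaussianReal 0 1) ≠ 0) (hv : v ≠ 0)
    (ha : a ≠ 0) {ε : ℝ} (hε : 0 < ε) :
    μ.real {ω | (∑ i, ∑ j, columnStd v a j ^ p * ((V ω * a).map σ) i j) /
        ∫ t, σ t ∂(gaussianReal 0 1) ≤ (1 - ε) * (N * ∑ j, (columnStd v a j ^ p) ^ 2)} ≤
      bernsteinTail (layerRate p σ) (min 1 (2 / p)) N ε := by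
  have htail := measureReal_sum_sum_le_one_sub_mul_le (α := min 1 (2 / p)) (by positivity)
    (min_le_left _ _) hp (min_le_right _ _) hσ.measurable hσ.abs_le rfl hσ_mean
    (sum_columnStd_rpow_sq_pos hv ha p)
    (fun i j => (hV.measurable_mul a i j).div_const (columnStd v a j))
    (fun i j hj => hV.hasLaw_mul_div_columnStd a i fun h => hj (by rw [h, Real.zero_rpow hp.ne']))
    (hV.iIndepFun_mul_div_columnStd a) hε
  simp only [sq (columnStd v a _ ^ p), mul_assoc, ← hσ.map_mul_apply hp.ne' hv,
    Fintype.card_fin] at htail ⊢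
  exact htail.trans (bernsteinTail_anti N.cast_nonneg hε.le (min_le_left _ _))

theorem measureReal_not_isStableLayer_le (hV : IsGaussianMatrix V v μ) (hp : 0 < p)
    (hσ : IsPosHomogeneous p σ) (hσ_mean : ∫ t, σ t ∂(gaussianReal 0 1) ≠ 0)
    (hv : d ≠ 0 → v ≠ 0) (a : Matrix (Fin d) (Fin n) ℝ) {ε₁ ε₂ : ℝ} (hε₁ : 0 < ε₁) (hε₂ : 0 < ε₂)
    (hε₂1 : ε₂ < 1) :
    μ.real {ω | ¬ IsStableLayer σ (stableRankBound σ ε₁ ε₂) (V ω) a} ≤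
      layerTail (layerRate p σ) p N ε₁ ε₂ := by
  rcases eq_or_ne a 0 with rfl | ha
  · simp [IsStableLayer, layerTail, add_nonneg, bernsteinTail_nonneg]
  rcases N.eq_zero_or_pos with rfl | hN
  · refine measureReal_le_one.trans ?_
    simp only [layerTail, Nat.cast_zero]
    rw [bernsteinTail_zero (by positivity), bernsteinTail_zero (by positivity)]
    norm_num
  have hv0 : v ≠ 0 := hv fun hd => ha (by subst hd; exact Subsingleton.elim _ _)
  have hσ_sq : 0 < ∫ t, σ t ^ 2 ∂(gaussianReal 0 1) := integral_sq_pos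
    (integrable_of_abs_le_rpow (by positivity) (hσ.measurable.pow_const 2) hσ.sq_abs_le) hσ_mean
  have hsum_pos := sum_columnStd_rpow_sq_pos hv0 ha p
  rw [layerTail, add_comm]
  refine (measureReal_mono fun ω hω => ?_).trans ((measureReal_union_le _ _).trans (add_le_add
    (hV.measureReal_frobNorm_sq_ge_le hp hσ hσ_sq.ne' hv0 ha hε₁)
    (hV.measureReal_sum_columnStd_mul_le_le hp hσ hσ_mean hv0 ha hε₂)))
  contrapose! hω
  simp only [Set.mem_union, Set.mem_ofPred_eq, not_or, not_le, not_not] at hω ⊢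
  exact fun _ => stableRank_le_stableRankBound hσ_mean hσ_sq hε₂1 (by positivity) hω.1 hω.2

end IsGaussianMatrix

end Layer

/-! ### The network -/

lemma measurable_opNorm {m n : ℕ} : Measurable fun A : Fin m → Fin n → ℝ => opNorm A := by
  have hcont : Continuous fun A : Fin m → Fin n → ℝ => opNorm A := @continuous_norm _
    Matrix.instL2OpNormedAddCommGroup.toSeminormedAddCommGroup.toSeminormedAddGroup
  exact hcont.measurable

lemma measurable_frobNorm {m n : ℕ} : Measurable fun A : Fin m → Fin n → ℝ => frobNorm A := by
  have hcont : Continuous fun A : Fin m → Fin n → ℝ => frobNorm A := @continuous_norm _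
    Matrix.frobeniusNormedAddCommGroup.toSeminormedAddCommGroup.toSeminormedAddGroup
  exact hcont.measurable

lemma measurable_stableRank {m n : ℕ} : Measurable fun A : Fin m → Fin n → ℝ => stableRank A :=
  (measurable_frobNorm.pow_const 2).div (measurable_opNorm.pow_const 2)

lemma measurable_map_mul {N d n : ℕ} {σ : ℝ → ℝ} (hσ : Measurable σ) :
    Measurable fun (x : (Fin d → Fin n → ℝ) × (Fin N → Fin d → ℝ)) (i : Fin N) (j : Fin n) =>
      σ (∑ k, x.2 i k * x.1 k j) := by
  fun_prop

lemma measurableSet_isStableLayer {N d n : ℕ} {σ : ℝ → ℝ} (hσ : Measurable σ) (R : ℝ) :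
    MeasurableSet {x : (Fin d → Fin n → ℝ) × (Fin N → Fin d → ℝ) |
      IsStableLayer σ R x.2 x.1} := by
  have hmap := measurable_map_mul (N := N) (d := d) (n := n) hσ
  exact ((measurableSet_singleton 0).preimage measurable_fst).compl.imp
    (((measurableSet_singleton 0).preimage hmap).compl.inter
      (measurableSet_le (measurable_stableRank.comp hmap) measurable_const))

lemma measureReal_prodMk_mem_le_of_indepFun {Ω 𝒳 𝒴 : Type*} [MeasurableSpace Ω]
    [MeasurableSpace 𝒳] [MeasurableSpace 𝒴] {μ : Measure Ω} [IsProbabilityMeasure μ] {A : Ω → 𝒳}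
    {V : Ω → 𝒴} (hind : IndepFun A V μ) (hA : Measurable A) (hV : Measurable V) {S : Set (𝒳 × 𝒴)}
    (hS : MeasurableSet S) {b : ℝ} (hb : ∀ a, μ.real {ω | (a, V ω) ∈ S} ≤ b) :
    μ.real {ω | (A ω, V ω) ∈ S} ≤ b := by
  have : IsProbabilityMeasure (μ.map A) := Measure.isProbabilityMeasure_map hA.aemeasurable
  obtain ⟨ω₀⟩ : Nonempty Ω := nonempty_of_isProbabilityMeasure μ
  have hb0 : 0 ≤ b := measureReal_nonneg.trans (hb (A ω₀))
  refine ENNReal.toReal_le_of_le_ofReal hb0 ?_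
  calc μ {ω | (A ω, V ω) ∈ S} = ((μ.map A).prod (μ.map V)) S := by
        rw [← hind.map_prod_eq_prod_map_map hA.aemeasurable hV.aemeasurable,
          Measure.map_apply (hA.prodMk hV) hS]
        rfl
    _ = ∫⁻ a, μ {ω | (a, V ω) ∈ S} ∂(μ.map A) := by
        rw [Measure.prod_apply hS]
        exact lintegral_congr fun a => Measure.map_apply hV (measurable_prodMk_left hS)
    _ ≤ ∫⁻ _, ENNReal.ofReal b ∂(μ.map A) := lintegral_mono fun a =>
        (ENNReal.le_ofReal_iff_toReal_le (measure_ne_top _ _) hb0).2 (hb a)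
    _ = ENNReal.ofReal b := by simp

section Network

variable {L : ℕ} {d : Fin (L + 1) → ℕ} {n : ℕ} {σ : ℝ → ℝ}

lemma postActivation_succ (σ : ℝ → ℝ)
    (W : (ℓ : Fin L) → Matrix (Fin (d ℓ.succ)) (Fin (d ℓ.castSucc)) ℝ)
    (X : Matrix (Fin (d 0)) (Fin n) ℝ) (ℓ : Fin L) :
    postActivation σ W X ℓ.succ = (W ℓ * postActivation σ W X ℓ.castSucc).map σ :=
  Fin.induction_succ _ _ _

lemma measurable_postActivation {Ω : Type*} [MeasurableSpace Ω] (hσ : Measurable σ)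
    {W : (ℓ : Fin L) → Ω → Matrix (Fin (d ℓ.succ)) (Fin (d ℓ.castSucc)) ℝ}
    (X : Matrix (Fin (d 0)) (Fin n) ℝ) (j : Fin (L + 1))
    (hW : ∀ ℓ, ℓ.castSucc < j → Measurable fun ω i k => W ℓ ω i k) :
    Measurable fun ω i k => postActivation σ (fun ℓ => W ℓ ω) X j i k := by
  induction j using Fin.induction with
  | zero => exact measurable_const (a := fun i k => X i k)
  | succ ℓ ih =>
    have hinput := ih fun k hk => hW k (hk.trans Fin.castSucc_lt_succ)
    simp only [postActivation_succ]
    exact (measurable_map_mul hσ).comp (hinput.prodMk (hW ℓ Fin.castSucc_lt_succ))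

lemma stableRank_postActivation_le (hσ : σ 0 = 0) {R : ℝ} (hR : 0 ≤ R)
    {W : (ℓ : Fin L) → Matrix (Fin (d ℓ.succ)) (Fin (d ℓ.castSucc)) ℝ}
    {X : Matrix (Fin (d 0)) (Fin n) ℝ}
    (hW : ∀ ℓ, IsStableLayer σ R (W ℓ) (postActivation σ W X ℓ.castSucc)) (ℓ : Fin L) :
    (X ≠ 0 → postActivation σ W X ℓ.succ ≠ 0) ∧
      stableRank (postActivation σ W X ℓ.succ) ≤ R := by
  constructor
  · intro hX
    induction ℓ.succ using Fin.induction with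
    | zero => exact hX
    | succ k ih => exact postActivation_succ σ W X k ▸ (hW k ih).1
  · rw [postActivation_succ]
    by_cases hinput : postActivation σ W X ℓ.castSucc = 0
    · rwa [hinput, Matrix.mul_zero, Matrix.map_zero _ hσ, stableRank_zero]
    · exact (hW ℓ hinput).2

namespace IsGaussianInit

variable {Ω : Type*} [MeasurableSpace Ω] {μ : Measure Ω}
  {W : (ℓ : Fin L) → Ω → Matrix (Fin (d ℓ.succ)) (Fin (d ℓ.castSucc)) ℝ}

lemma isGaussianMatrix (hW : IsGaussianInit μ W) (ℓ : Fin L) :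
    IsGaussianMatrix (W ℓ) ((d ℓ.castSucc : ℝ≥0)⁻¹) μ where
  measurable := hW.measurable ℓ
  hasLaw i k := ⟨(hW.measurable ℓ i k).aemeasurable, hW.law ℓ i k⟩
  indep := hW.indep.precomp (g := fun x => ⟨ℓ, x⟩) fun x y hxy => by simpa using hxy

lemma measurable_apply (hW : IsGaussianInit μ W) (ℓ : Fin L) :
    Measurable fun ω i k => W ℓ ω i k :=
  measurable_pi_lambda _ fun i => measurable_pi_lambda _ (hW.measurable ℓ i)

lemma indepFun_postActivation (hW : IsGaussianInit μ W) (hσ : Measurable σ)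
    (X : Matrix (Fin (d 0)) (Fin n) ℝ) (ℓ : Fin L) :
    IndepFun (fun ω i k => postActivation σ (fun ℓ => W ℓ ω) X ℓ.castSucc i k)
      (fun ω i k => W ℓ ω i k) μ := by
  have hdisj : Disjoint {x : (ℓ : Fin L) × (Fin (d ℓ.succ) × Fin (d ℓ.castSucc)) | x.1 < ℓ}
      {x | x.1 = ℓ} := Set.disjoint_left.2 fun _ hlt heq => hlt.ne heq
  have hlayer (S : Set ((ℓ : Fin L) × (Fin (d ℓ.succ) × Fin (d ℓ.castSucc)))) (m : Fin L)
      (hm : ∀ x, ⟨m, x⟩ ∈ S) : Measurable[⨆ x ∈ S, MeasurableSpace.comap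
        (fun ω => W x.1 ω x.2.1 x.2.2) inferInstance] fun ω i k => W m ω i k :=
    @measurable_pi_lambda _ _ _ (_) _ _ fun i => @measurable_pi_lambda _ _ _ (_) _ _ fun k =>
      measurable_iff_comap_le.2 (le_iSup₂_of_le ⟨m, (i, k)⟩ (hm _) le_rfl)
  have hindep : iIndep (fun x : (ℓ : Fin L) × (Fin (d ℓ.succ) × Fin (d ℓ.castSucc)) =>
      MeasurableSpace.comap (fun ω => W x.1 ω x.2.1 x.2.2) inferInstance) μ := hW.indep
  refine (IndepFun_iff_Indep _ _ _).2 (indep_of_indep_of_le_left (indep_of_indep_of_le_right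
    (indep_iSup_of_disjoint (fun x => (hW.measurable x.1 x.2.1 x.2.2).comap_le) hindep hdisj)
    ?_) ?_)
  · exact (hlayer _ ℓ fun _ => rfl).comap_le
  · exact (@measurable_postActivation _ _ _ _ _ (_) hσ _ X _ fun m hm =>
      hlayer _ m fun _ => hm).comap_le

variable [IsProbabilityMeasure μ] {p ε₁ ε₂ : ℝ}

lemma measureReal_not_isStableLayer_le (hW : IsGaussianInit μ W) (hp : 0 < p)
    (hσ : IsPosHomogeneous p σ) (hσ_mean : ∫ t, σ t ∂(gaussianReal 0 1) ≠ 0) (hε₁ : 0 < ε₁)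
    (hε₂ : 0 < ε₂) (hε₂1 : ε₂ < 1) (X : Matrix (Fin (d 0)) (Fin n) ℝ) (ℓ : Fin L) :
    μ.real {ω | ¬ IsStableLayer σ (stableRankBound σ ε₁ ε₂) (W ℓ ω)
        (postActivation σ (fun ℓ => W ℓ ω) X ℓ.castSucc)} ≤
      layerTail (layerRate p σ) p (d ℓ.succ) ε₁ ε₂ :=
  measureReal_prodMk_mem_le_of_indepFun (hW.indepFun_postActivation hσ.measurable X ℓ)
    (measurable_postActivation hσ.measurable X _ fun m _ => hW.measurable_apply m)
    (hW.measurable_apply ℓ) (measurableSet_isStableLayer hσ.measurable _).compl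
    ((hW.isGaussianMatrix ℓ).measureReal_not_isStableLayer_le hp hσ hσ_mean
      (fun hd => by simpa using hd) · hε₁ hε₂ hε₂1)

theorem one_sub_sum_layerTail_le (hW : IsGaussianInit μ W) (hp : 0 < p)
    (hσ : IsPosHomogeneous p σ) (hσ_mean : ∫ t, σ t ∂(gaussianReal 0 1) ≠ 0) (hε₁ : 0 < ε₁)
    (hε₂ : 0 < ε₂) (hε₂1 : ε₂ < 1) (X : Matrix (Fin (d 0)) (Fin n) ℝ) :
    1 - ∑ ℓ : Fin L, layerTail (layerRate p σ) p (d ℓ.succ) ε₁ ε₂ ≤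
      μ.real {ω | ∀ ℓ : Fin L, (X ≠ 0 → postActivation σ (fun k => W k ω) X ℓ.succ ≠ 0) ∧
        stableRank (postActivation σ (fun k => W k ω) X ℓ.succ) ≤ stableRankBound σ ε₁ ε₂} := by
  have hR : 0 ≤ stableRankBound σ ε₁ ε₂ := by
    have : 0 ≤ ∫ t, σ t ^ 2 ∂(gaussianReal 0 1) := integral_nonneg fun t => sq_nonneg (σ t)
    rw [stableRankBound]
    positivity
  set unstable : Fin L → Set Ω := fun ℓ => {ω | ¬ IsStableLayer σ (stableRankBound σ ε₁ ε₂)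
    (W ℓ ω) (postActivation σ (fun ℓ => W ℓ ω) X ℓ.castSucc)}
  have hunion : μ.real (⋃ ℓ, unstable ℓ) ≤
      ∑ ℓ : Fin L, layerTail (layerRate p σ) p (d ℓ.succ) ε₁ ε₂ :=
    (measureReal_iUnion_fintype_le _).trans (Finset.sum_le_sum fun ℓ _ =>
      hW.measureReal_not_isStableLayer_le hp hσ hσ_mean hε₁ hε₂ hε₂1 X ℓ)
  have hcompl : 1 - μ.real (⋃ ℓ, unstable ℓ) ≤ μ.real (⋃ ℓ, unstable ℓ)ᶜ := by
    have := measureReal_union_le (μ := μ) (⋃ ℓ, unstable ℓ) (⋃ ℓ, unstable ℓ)ᶜ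
    rw [Set.union_compl_self, probReal_univ] at this
    linarith
  refine (by linarith : _ ≤ μ.real (⋃ ℓ, unstable ℓ)ᶜ).trans (measureReal_mono fun ω hω => ?_)
  simp only [unstable, Set.mem_compl_iff, Set.mem_iUnion, Set.mem_ofPred_eq, not_exists,
    not_not] at hω
  exact stableRank_postActivation_le (hσ.map_zero hp.ne') hR hω

end IsGaussianInit

end Network

theorem mainTheorem2_general (p : ℝ) (hp : 0 < p) (s₁ s₂ : ℝ) :
    ∃ c : ℝ, 0 < c ∧
      ∀ (σ : ℝ → ℝ), IsPosHomogeneous p σ → σ 1 = s₁ → σ (-1) = s₂ →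
        ∫ t, σ t ∂(gaussianReal 0 1) ≠ 0 →
      ∀ (ε₁ ε₂ : ℝ), 0 < ε₁ → 0 < ε₂ → ε₂ < 1 →
      ∀ (L : ℕ) (d : Fin (L + 1) → ℕ) (n : ℕ) (X : Matrix (Fin (d 0)) (Fin n) ℝ)
        (Ω : Type*) [MeasurableSpace Ω] (μ : Measure Ω) [IsProbabilityMeasure μ]
        (W : (ℓ : Fin L) → Ω → Matrix (Fin (d ℓ.succ)) (Fin (d ℓ.castSucc)) ℝ),
        IsGaussianInit μ W →
        1 - ∑ ℓ : Fin L, layerTail c p (d ℓ.succ) ε₁ ε₂ ≤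
          μ.real {ω | ∀ ℓ : Fin L,
            (X ≠ 0 → postActivation σ (fun k => W k ω) X ℓ.succ ≠ 0) ∧
            stableRank (postActivation σ (fun k => W k ω) X ℓ.succ) ≤
              stableRankBound σ ε₁ ε₂} := by
  refine ⟨layerRate p (signedPower p s₁ s₂), layerRate_pos hp _, ?_⟩
  rintro σ hσ rfl rfl hσ_mean ε₁ ε₂ hε₁ hε₂ hε₂1 L d n X Ω _ μ _ W hW
  rw [← hσ.eq_signedPower]
  exact hW.one_sub_sum_layerTail_le hp hσ hσ_mean hε₁ hε₂ hε₂1 X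

theorem mainTheorem2 (p : ℝ) (hp : 1 ≤ p) (s₁ s₂ m₁ : ℝ) (hm₁ : 0 < m₁) :
    ∃ c : ℝ, 0 < c ∧
      ∀ (σ : ℝ → ℝ) (Lσ : ℝ), IsPosHomogeneous p σ → σ 0 = 0 → (∀ t, |σ t| ≤ Lσ * |t| ^ p) →
        σ 1 = s₁ → σ (-1) = s₂ → |∫ t, σ t ∂(gaussianReal 0 1)| = m₁ →
      ∀ (ε₁ ε₂ : ℝ), 0 < ε₁ → ε₁ ≤ 1 → 0 < ε₂ → ε₂ < 1 →
      ∀ (L : ℕ) (d : Fin (L + 1) → ℕ) (n : ℕ) (X : Matrix (Fin (d 0)) (Fin n) ℝ)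
        (Ω : Type*) [MeasurableSpace Ω] (μ : Measure Ω) [IsProbabilityMeasure μ]
        (W : (ℓ : Fin L) → Ω → Matrix (Fin (d ℓ.succ)) (Fin (d ℓ.castSucc)) ℝ),
        IsGaussianInit μ W →
        1 - ∑ ℓ : Fin L,
            (2 * Real.exp (-c * min ((d ℓ.succ : ℝ) * ε₂ ^ 2)
                ((d ℓ.succ : ℝ) ^ min 1 (2 / p) * ε₂ ^ (2 / p)))
              + 2 * Real.exp (-c * min ((d ℓ.succ : ℝ) * ε₁ ^ 2)
                ((d ℓ.succ : ℝ) ^ min 1 (1 / p) * ε₁ ^ (1 / p))))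
          ≤ μ.real {ω | ∀ ℓ : Fin L,
              (X ≠ 0 → postActivation σ (fun k => W k ω) X ℓ.succ ≠ 0) ∧
              stableRank (postActivation σ (fun k => W k ω) X ℓ.succ)
                ≤ (1 + ε₁) / (1 - ε₂) ^ 2 *
                  ((∫ t, σ t ^ 2 ∂(gaussianReal 0 1)) / m₁ ^ 2)} := by
  obtain ⟨c, hc, hbound⟩ := mainTheorem2_general p (by linarith) s₁ s₂
  refine ⟨c, hc, ?_⟩
  intro σ _ hσ _ _ h1 h2 hmean ε₁ ε₂ hε₁ hε₁1 hε₂ hε₂1 L d n X Ω _ μ _ W hW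
  have hσ_mean : ∫ t, σ t ∂(gaussianReal 0 1) ≠ 0 := abs_pos.1 (hmean ▸ hm₁)
  rw [← hmean, sq_abs]
  refine le_trans (sub_le_sub_left (Finset.sum_le_sum fun ℓ _ => ?_) 1)
    (hbound σ hσ h1 h2 hσ_mean ε₁ ε₂ hε₁ hε₂ hε₂1 L d n X Ω μ W hW)
  exact add_le_add (bernsteinTail_min_one_le hc.le (Nat.cast_nonneg _) hε₂ hε₂1.le)
    (bernsteinTail_min_one_le hc.le (Nat.cast_nonneg _) hε₁ hε₁1)
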